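/- Let $V_4=\{0<a<b<1\}$ be the four-element chain, with Gödel implication $x\Rightarrow y=1$ if $x\le y$ and $x\Rightarrow y=y$ if $x>y$. For $n\ge 1$ consider all full bracketings of the word $p_1\Rightarrow p_2\Rightarrow\cdots\Rightarrow p_n$ in $n$ distinct variables, and evaluate each of them under all $4^n$ valuations $\{p_1,\dots,p_n\}\to V_4$. Let $f_n,a_n,b_n,t_n$ be the total numbers, over all bracketings and all valuations, of outputs equal to $0,a,b,1$ respectively, and let $g_n=f_n+a_n+b_n+t_n$. Put \[ \beta=\sqrt{7+2\sqrt2},\qquad \alpha=1+\sqrt2+\beta,\qquad \gamma=\sqrt{16+\alpha^2}. \] Then the limits \[ p_\bot=\lim_{n\to\infty}\frac{f_n}{g_n},\qquad p_a=\lim_{n\to\infty}\frac{a_n}{g_n},\qquad p_b=\lim_{n\to\infty}\frac{b_n}{g_n},\qquad p_\top=\lim_{n\to\infty}\frac{t_n}{g_n} \] exist and satisfy $p_\bot+p_a+p_b+p_\top=1$. Moreover, they are given exactly by \[ p_\bot=\frac12-\frac{\sqrt2}{4},\qquad p_a=\frac{2+\sqrt2}{2\alpha\beta},\qquad p_b=\frac{(2+\sqrt2)\,\alpha}{\beta\gamma(\alpha+\gamma)},\qquad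 p_\top=\frac{(2+\sqrt2)\,\alpha(\alpha+\gamma)}{16\beta\gamma}. \] In particular, $p_\top=0.684122210733017786\ldots$ (all displayed decimals being exact). -/

import Mathlib

open Filter Topology

/-- The four-element chain of truth values `0 < a < b < 1`, realised as `Fin 4` with its usual
linear order: `0`, `1`, `2`, `3` stand for the truth values `0`, `a`, `b`, `1` respectively. -/
abbrev V4 : Type := Fin 4

/-- Gödel implication on the chain: `x ⇒ y` is the top value if `x ≤ y`, and `y` if `x > y`. -/
def godelImp (x y : V4) : V4 := if x ≤ y then 3 else y

/-- `Bracketing n` is the type of full bracketings of the word `p₁ ⇒ p₂ ⇒ ⋯ ⇒ pₙ` in `n` distinct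
variables: either the single variable `p₁` (for `n = 1`), or an implication `φ ⇒ ψ`, where `φ`
brackets the subword on the first `i` variables and `ψ` the one on the remaining `j`. -/
inductive Bracketing : ℕ → Type
  | var : Bracketing 1
  | imp {i j : ℕ} (φ : Bracketing i) (ψ : Bracketing j) : Bracketing (i + j)

/-- The truth value of a bracketing in `n` variables under a valuation `ν` of these variables. -/
def Bracketing.eval : {n : ℕ} → Bracketing n → (Fin n → V4) → V4
  | _, .var, ν => ν 0
  | _, .imp (i := i) (j := j) φ ψ, ν =>
      godelImp (φ.eval (fun k => ν (Fin.castAdd j k))) (ψ.eval (fun k => ν (Fin.natAdd i k)))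

/-- The number of occurrences of the value `v` in the output columns of the truth tables of all
bracketings in `n` variables, i.e. the number of pairs (bracketing, valuation) with output `v`. -/
noncomputable def outputCount (v : V4) (n : ℕ) : ℕ :=
  Nat.card {p : Bracketing n × (Fin n → V4) // p.1.eval p.2 = v}

/-- `fₙ`, the number of zeros. -/
noncomputable def fCount (n : ℕ) : ℕ := outputCount 0 n

/-- `aₙ`, the number of `a`'s. -/
noncomputable def aCount (n : ℕ) : ℕ := outputCount 1 n

/-- `bₙ`, the number of `b`'s. -/
noncomputable def bCount (n : ℕ) : ℕ := outputCount 2 n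

/-- `tₙ`, the number of ones. -/
noncomputable def tCount (n : ℕ) : ℕ := outputCount 3 n

/-- `gₙ = fₙ + aₙ + bₙ + tₙ`, the total number of truth table entries. -/
noncomputable def gCount (n : ℕ) : ℕ := fCount n + aCount n + bCount n + tCount n

/-! Splitting at the outermost implication gives convolution recursions. An implication has value `v
< 1` exactly when its right side has value `v` and its left side a larger value. So each of `f`,
`a`, `b` satisfies `h = [n = 1] + r * h`, where `r` counts the values above `v`. With `w = r + h`
this reads `h = [n = 1] + (w - h) * h`. The total satisfies `g = 4[n = 1] + g * g`, hence is `4 ^ n`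
times a Catalan number and grows like `16 ^ n` up to a polynomial factor.

Singularity analysis is replaced by an elementary ratio argument. The sequence `c n = g n / 16 ^ n`
has sum `1 / 2`, satisfies `c (n - 1) / c n → 1`, and eventually equals `c * c`. For `0 ≤ p, q ≤ c`
with sums `P`, `Q` and `p / c → a`, `q / c → b`, the ratio of `p * q` to `c` tends to `P b + Q a`
(`Near.conv`). Existence of the limit of `h / c` is not known beforehand, so `Near` carries an
asymptotic error; the recursion at least halves it (`tendsto_of_recursion`), and the limit is the
fixed point.

At the point `1` the recursion also becomes a quadratic for the sum of `h`. `split_count` combines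
the two and is applied three times, peeling `f` off `g`, then `a`, then `b`; `t` is what remains. -/

/-! ### Decomposition of valued bracketings at the outermost implication. -/

/-- A bracketing together with a valuation of its variables. -/
abbrev ValuedBracketing : Type := Σ n : ℕ, Bracketing n × (Fin n → V4)

namespace ValuedBracketing

/-- The truth value of a bracketing under the valuation it is equipped with. -/
def value (x : ValuedBracketing) : V4 := x.2.1.eval x.2.2

/-- The implication of two valued bracketings. -/
def imp (x y : ValuedBracketing) : ValuedBracketing :=
  ⟨x.1 + y.1, x.2.1.imp y.2.1, Fin.append x.2.2 y.2.2⟩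

theorem value_imp (x y : ValuedBracketing) : (imp x y).value = godelImp x.value y.value := by
  simp [value, imp, Bracketing.eval]

/-- A valued bracketing is either an implication or a variable with its value. -/
def equivSum : ValuedBracketing ≃ (ValuedBracketing × ValuedBracketing) ⊕ V4 where
  toFun
    | ⟨_, .var, ν⟩ => .inr (ν 0)
    | ⟨_, .imp (i := i) (j := j) φ ψ, ν⟩ =>
      .inl (⟨i, φ, fun k => ν (Fin.castAdd j k)⟩, ⟨j, ψ, fun k => ν (Fin.natAdd i k)⟩)
  invFun
    | .inl (x, y) => imp x y
    | .inr v => ⟨1, .var, fun _ => v⟩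
  left_inv := by
    rintro ⟨_, _ | ⟨φ, ψ⟩, ν⟩
    · simp only [Sigma.mk.injEq, heq_eq_eq, Prod.mk.injEq, true_and]
      funext k
      rw [Subsingleton.elim k 0]
    · simp only [imp, Sigma.mk.injEq, heq_eq_eq, Prod.mk.injEq, true_and]
      exact Fin.append_castAdd_natAdd
  right_inv := by
    rintro (⟨⟨i, φ, ν⟩, ⟨j, ψ, μ⟩⟩ | v)
    · simp [imp]
    · rfl

/-- The valued bracketings in `n` variables with value `v`. -/
abbrev Fiber (v : V4) (n : ℕ) : Type := {x : ValuedBracketing // x.1 = n ∧ x.value = v}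

/-- The fibers are counted by `outputCount`. -/
def fiberEquiv (v : V4) (n : ℕ) :
    {p : Bracketing n × (Fin n → V4) // p.1.eval p.2 = v} ≃ Fiber v n where
  toFun p := ⟨⟨n, p.1⟩, rfl, p.2⟩
  invFun x := ⟨x.2.1 ▸ x.1.2, by
    obtain ⟨⟨m, p⟩, rfl, h⟩ := x
    exact h⟩
  left_inv _ := rfl
  right_inv := by
    rintro ⟨⟨m, p⟩, rfl, h⟩
    rfl

theorem card_fiber (v : V4) (n : ℕ) : Nat.card (Fiber v n) = outputCount v n :=
  (Nat.card_congr (fiberEquiv v n)).symm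

/-- The sizes and values of two subformulas whose implication has `n` variables and value `v`. -/
abbrev SplitIndex (v : V4) (n : ℕ) : Type :=
  {t : (ℕ × ℕ) × (V4 × V4) //
    t ∈ Finset.HasAntidiagonal.antidiagonal n ×ˢ Finset.univ.filter (fun u : V4 × V4 => godelImp u.1 u.2 = v)}

/-- Decomposition of the implications of a given size and value. -/
def impSplit (v : V4) (n : ℕ) :
    {p : ValuedBracketing × ValuedBracketing // (imp p.1 p.2).1 = n ∧ (imp p.1 p.2).value = v} ≃
      Σ t : SplitIndex v n, Fiber t.1.2.1 t.1.1.1 × Fiber t.1.2.2 t.1.1.2 where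
  toFun p := ⟨⟨((p.1.1.1, p.1.2.1), (p.1.1.value, p.1.2.value)), by
    rw [Finset.mem_product, Finset.mem_filter, ← value_imp]
    exact ⟨Finset.HasAntidiagonal.mem_antidiagonal.mpr p.2.1, Finset.mem_univ _, p.2.2⟩⟩,
    ⟨p.1.1, rfl, rfl⟩, ⟨p.1.2, rfl, rfl⟩⟩
  invFun q := ⟨(q.2.1.1, q.2.2.1), by
    obtain ⟨⟨⟨⟨i, j⟩, u, w⟩, ht⟩, ⟨x, hx⟩, ⟨y, hy⟩⟩ := q
    obtain ⟨rfl, rfl⟩ : x.1 = i ∧ x.value = u := hx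
    obtain ⟨rfl, rfl⟩ : y.1 = j ∧ y.value = w := hy
    rw [Finset.mem_product, Finset.mem_filter, ← value_imp] at ht
    exact ⟨Finset.HasAntidiagonal.mem_antidiagonal.mp ht.1, ht.2.2⟩⟩
  left_inv _ := rfl
  right_inv := by
    rintro ⟨⟨⟨⟨i, j⟩, u, w⟩, ht⟩, ⟨x, hx⟩, ⟨y, hy⟩⟩
    obtain ⟨rfl, rfl⟩ : x.1 = i ∧ x.value = u := hx
    obtain ⟨rfl, rfl⟩ : y.1 = j ∧ y.value = w := hy
    rfl

/-- Decomposition of a fiber according to the outermost connective. -/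
def fiberSplit (v : V4) (n : ℕ) :
    Fiber v n ≃ (Σ t : SplitIndex v n, Fiber t.1.2.1 t.1.1.1 × Fiber t.1.2.2 t.1.1.2) ⊕
      {u : V4 // 1 = n ∧ u = v} :=
  calc
    Fiber v n ≃ {y : (ValuedBracketing × ValuedBracketing) ⊕ V4 //
        (equivSum.symm y).1 = n ∧ (equivSum.symm y).value = v} :=
      (equivSum.symm.subtypeEquiv fun _ => Iff.rfl).symm
    _ ≃ {p : ValuedBracketing × ValuedBracketing //
          (imp p.1 p.2).1 = n ∧ (imp p.1 p.2).value = v} ⊕ {u : V4 // 1 = n ∧ u = v} :=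
      Equiv.subtypeSum
    _ ≃ _ := Equiv.sumCongr (impSplit v n) (Equiv.refl _)

theorem one_le_size {n : ℕ} (φ : Bracketing n) : 1 ≤ n := by
  induction φ with
  | var => exact le_rfl
  | imp _ _ h _ => omega

theorem isEmpty_fiber_zero (v : V4) : IsEmpty (Fiber v 0) :=
  ⟨fun x => absurd (one_le_size x.1.2.1) (by rw [x.2.1]; omega)⟩

/-- Needed because `Nat.card` of an infinite type is `0`, so cardinalities add only over finite
pieces. Size `0` is empty, hence both halves of a nonempty split are strictly smaller. -/
theorem finite_fiber (n : ℕ) : ∀ v : V4, Finite (Fiber v n) := by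
  induction n using Nat.strong_induction_on with
  | _ n ih =>
    intro v
    have : ∀ t : SplitIndex v n, Finite (Fiber t.1.2.1 t.1.1.1 × Fiber t.1.2.2 t.1.1.2) := by
      rintro ⟨⟨⟨i, j⟩, u, w⟩, ht⟩
      simp only [Finset.mem_product, Finset.HasAntidiagonal.mem_antidiagonal] at ht
      rcases Nat.eq_zero_or_pos i with rfl | hi
      · have := isEmpty_fiber_zero u
        infer_instance
      rcases Nat.eq_zero_or_pos j with rfl | hj
      · have := isEmpty_fiber_zero w
        infer_instance
      have := ih i (by omega) u
      have := ih j (by omega) w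
      infer_instance
    exact Finite.of_equiv _ (fiberSplit v n).symm

end ValuedBracketing

/-! ### Convolution recursions and the Catalan formula for the total. -/

open ValuedBracketing in
theorem outputCount_zero (v : V4) : outputCount v 0 = 0 := by
  rw [← card_fiber]
  have := isEmpty_fiber_zero v
  exact Nat.card_of_isEmpty

open ValuedBracketing in
theorem outputCount_eq (v : V4) (n : ℕ) :
    outputCount v n = (if n = 1 then 1 else 0) +
      ∑ p ∈ Finset.HasAntidiagonal.antidiagonal n, ∑ x : V4, ∑ y : V4,
        if godelImp x y = v then outputCount x p.1 * outputCount y p.2 else 0 := by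
  have := finite_fiber
  rw [← card_fiber, Nat.card_congr (fiberSplit v n), Nat.card_sum, Nat.card_sigma, add_comm]
  congr 1
  · split_ifs with h
    · subst h
      simp
    · have : IsEmpty {u : V4 // 1 = n ∧ u = v} := ⟨fun u => h u.2.1.symm⟩
      exact Nat.card_of_isEmpty
  · simp only [Nat.card_prod, card_fiber]
    rw [Finset.sum_coe_sort (Finset.HasAntidiagonal.antidiagonal n ×ˢ
      Finset.univ.filter (fun u : V4 × V4 => godelImp u.1 u.2 = v))
      (fun t => outputCount t.2.1 t.1.1 * outputCount t.2.2 t.1.2), Finset.sum_product]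
    refine Finset.sum_congr rfl fun p _ => ?_
    rw [Finset.sum_filter, ← Finset.univ_product_univ, Finset.sum_product]

theorem fCount_eq (n : ℕ) : fCount n = (if n = 1 then 1 else 0) +
    ∑ p ∈ Finset.HasAntidiagonal.antidiagonal n, (aCount p.1 + bCount p.1 + tCount p.1) * fCount p.2 := by
  rw [fCount, outputCount_eq]
  congr 1
  refine Finset.sum_congr rfl fun p _ => ?_
  simp [Fin.sum_univ_four, godelImp, fCount, aCount, bCount, tCount]
  ring

theorem aCount_eq (n : ℕ) : aCount n = (if n = 1 then 1 else 0) +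
    ∑ p ∈ Finset.HasAntidiagonal.antidiagonal n, (bCount p.1 + tCount p.1) * aCount p.2 := by
  rw [aCount, outputCount_eq]
  congr 1
  refine Finset.sum_congr rfl fun p _ => ?_
  simp [Fin.sum_univ_four, godelImp, aCount, bCount, tCount]
  ring

theorem bCount_eq (n : ℕ) : bCount n = (if n = 1 then 1 else 0) +
    ∑ p ∈ Finset.HasAntidiagonal.antidiagonal n, tCount p.1 * bCount p.2 := by
  rw [bCount, outputCount_eq]
  congr 1
  refine Finset.sum_congr rfl fun p _ => ?_
  simp [Fin.sum_univ_four, godelImp, bCount, tCount]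

/-- Each pair of input values has exactly one output, so summing over outputs removes the condition
on `godelImp`. -/
theorem gCount_eq (n : ℕ) : gCount n = (if n = 1 then 4 else 0) +
    ∑ p ∈ Finset.HasAntidiagonal.antidiagonal n, gCount p.1 * gCount p.2 := by
  have h : gCount n = ∑ v : V4, outputCount v n := by
    simp [gCount, fCount, aCount, bCount, tCount, Fin.sum_univ_four]
  rw [h, Finset.sum_congr rfl fun v _ => outputCount_eq v n, Finset.sum_add_distrib,
    Finset.sum_comm]
  congr 1
  · split_ifs <;> simp
  refine Finset.sum_congr rfl fun p _ => ?_
  simp [Fin.sum_univ_four, godelImp, gCount, fCount, aCount, bCount, tCount]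
  ring

theorem gCount_zero : gCount 0 = 0 := by
  simp [gCount, fCount, aCount, bCount, tCount, outputCount_zero]

theorem gCount_succ (n : ℕ) : gCount (n + 1) = 4 ^ (n + 1) * catalan n := by
  induction n using Nat.strong_induction_on with
  | _ n ih =>
    rw [gCount_eq]
    rcases n with _ | n
    · simp [Finset.Nat.antidiagonal_succ, gCount_zero]
    · rw [Finset.Nat.sum_antidiagonal_succ, Finset.Nat.sum_antidiagonal_succ', gCount_zero,
        catalan_succ', Finset.mul_sum]
      simp only [zero_mul, mul_zero, zero_add, Nat.add_eq_right, Nat.succ_ne_zero,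
        if_false]
      refine Finset.sum_congr rfl fun p hp => ?_
      rw [Finset.HasAntidiagonal.mem_antidiagonal] at hp
      rw [ih p.1 (by omega), ih p.2 (by omega), ← hp]
      ring

theorem gCount_succ_pos (n : ℕ) : 0 < gCount (n + 1) := by
  have h : 0 < (n + 1) * catalan n := by
    rw [succ_mul_catalan_eq_centralBinom]
    exact Nat.centralBinom_pos n
  rw [gCount_succ]
  exact Nat.mul_pos (by positivity) (Nat.pos_of_mul_pos_left h)

/-- This first-order recurrence, inherited from the central binomial coefficients, yields both the
slow variation and the summability of the rescaled sequence. -/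
theorem gCount_ratio (n : ℕ) :
    ((n : ℝ) + 2) * gCount (n + 2) = 8 * (2 * n + 1) * gCount (n + 1) := by
  have h1 := succ_mul_catalan_eq_centralBinom n
  have h2 := succ_mul_catalan_eq_centralBinom (n + 1)
  have h3 := Nat.succ_mul_centralBinom_succ n
  rw [← h1, ← h2] at h3
  have h4 : (n + 2) * catalan (n + 1) = 2 * (2 * n + 1) * catalan n := by
    refine Nat.eq_of_mul_eq_mul_left (Nat.succ_pos n) ?_
    simp only [Nat.succ_eq_add_one] at h3 ⊢
    linarith
  rw [gCount_succ, gCount_succ]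
  have h5 : ((n : ℝ) + 2) * catalan (n + 1) = 2 * (2 * n + 1) * catalan n := by exact_mod_cast h4
  push_cast
  linear_combination (4 : ℝ) ^ (n + 2) * h5

/-! ### Ratio asymptotics with an error term, and their behaviour under convolution. -/

/-- The sequence `q` is eventually within `(e + η) * c` of `b * c`, for every `η > 0`. -/
def Near (c q : ℕ → ℝ) (b e : ℝ) : Prop :=
  ∀ η > 0, ∀ᶠ n in atTop, |q n - b * c n| ≤ (e + η) * c n

/-- Positive sequences of sum `1 / 2` which vary slowly and agree with their own convolution square
from some index on. -/
structure IsConvolutionIdempotent (c : ℕ → ℝ) : Prop where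
  nonneg : ∀ n, 0 ≤ c n
  eventually_pos : ∀ᶠ n in atTop, 0 < c n
  near_pred : Near c (fun n => c (n - 1)) 1 0
  conv_self : ∀ᶠ n in atTop, ∑ p ∈ Finset.HasAntidiagonal.antidiagonal n, c p.1 * c p.2 = c n
  hasSum : HasSum c (1 / 2)

namespace Near

variable {c p q : ℕ → ℝ} {a b d e : ℝ}

theorem congr' (hq : Near c q b e) (h : ∀ᶠ n in atTop, q n = p n) : Near c p b e := by
  intro η hη
  filter_upwards [hq η hη, h] with n h1 h2
  rwa [← h2]

theorem add (hp : Near c p a d) (hq : Near c q b e) :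
    Near c (fun n => p n + q n) (a + b) (d + e) := by
  intro η hη
  filter_upwards [hp (η / 2) (by positivity), hq (η / 2) (by positivity)] with n h1 h2
  calc |p n + q n - (a + b) * c n| = |(p n - a * c n) + (q n - b * c n)| := by ring_nf
    _ ≤ |p n - a * c n| + |q n - b * c n| := abs_add_le _ _
    _ ≤ (d + e + η) * c n := by linarith

theorem const_mul (hc : ∀ n, 0 ≤ c n) (t : ℝ) (hq : Near c q b e) :
    Near c (fun n => t * q n) (t * b) (|t| * e) := by
  intro η hη
  filter_upwards [hq (η / (|t| + 1)) (by positivity)] with n h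
  have h0 : t * q n - t * b * c n = t * (q n - b * c n) := by ring
  rw [h0, abs_mul]
  refine (mul_le_mul_of_nonneg_left h (abs_nonneg t)).trans ?_
  rw [← mul_assoc]
  refine mul_le_mul_of_nonneg_right ?_ (hc n)
  have : |t| * (η / (|t| + 1)) ≤ η := by
    rw [← mul_div_assoc, div_le_iff₀ (by positivity)]
    nlinarith [abs_nonneg t]
  linarith

theorem weaken (hc : ∀ n, 0 ≤ c n) (hq : Near c q b e) (h : |a - b| + e ≤ d) : Near c q a d := by
  intro η hη
  filter_upwards [hq η hη] with n h1
  have h2 : q n - a * c n = (q n - b * c n) + (b - a) * c n := by ring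
  have h3 : |(b - a) * c n| = |a - b| * c n := by
    rw [abs_mul, abs_of_nonneg (hc n), abs_sub_comm]
  calc |q n - a * c n| ≤ |q n - b * c n| + |(b - a) * c n| := by rw [h2]; exact abs_add_le _ _
    _ ≤ (e + η) * c n + |a - b| * c n := by rw [h3]; gcongr
    _ = (|a - b| + e + η) * c n := by ring
    _ ≤ (d + η) * c n := mul_le_mul_of_nonneg_right (by linarith) (hc n)

theorem of_forall_gt (h : ∀ d > e, Near c q b d) : Near c q b e := by
  intro η hη
  filter_upwards [h (e + η / 2) (by linarith) (η / 2) (by positivity)] with n h1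
  convert h1 using 2
  ring

theorem tendsto_div (hc : ∀ᶠ n in atTop, 0 < c n) (hq : Near c q b 0) :
    Tendsto (fun n => q n / c n) atTop (𝓝 b) := by
  rw [Metric.tendsto_nhds]
  intro η hη
  filter_upwards [hc, hq (η / 2) (by positivity)] with n h1 h2
  have h3 : q n / c n - b = (q n - b * c n) / c n := by field_simp
  rw [Real.dist_eq, h3, abs_div, abs_of_pos h1]
  calc |q n - b * c n| / c n ≤ η / 2 := by rw [div_le_iff₀ h1]; linarith
    _ < η := by linarith

theorem self (hc : ∀ n, 0 ≤ c n) : Near c c 1 0 := by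
  intro η hη
  filter_upwards with n
  rw [one_mul, sub_self, abs_zero, zero_add]
  exact mul_nonneg hη.le (hc n)

theorem pred (hc : IsConvolutionIdempotent c) (he : 0 ≤ e) (hq : Near c q b e) :
    Near c (fun n => q (n - 1)) b e := by
  intro η hη
  have hpos : 0 < e + η / 2 + |b| := by positivity
  filter_upwards [(tendsto_sub_atTop_nat 1).eventually (hq (η / 2) (by positivity)),
    hc.near_pred (η / 2 / (e + η / 2 + |b|)) (by positivity)] with n h1 h2
  -- Replacing `c (n - 1)` by `c n` at relative cost `θ` adds `θ * (e + η / 2 + |b|)` to the error;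
  -- `θ` makes this the unused `η / 2`.
  set θ := η / 2 / (e + η / 2 + |b|) with hθ
  have h3 : θ * (e + η / 2 + |b|) = η / 2 := by
    rw [hθ]
    field_simp
  rw [one_mul, zero_add] at h2
  have h4 : c (n - 1) ≤ (1 + θ) * c n := by linarith [(abs_le.mp h2).2]
  have h5 : q (n - 1) - b * c n = (q (n - 1) - b * c (n - 1)) + b * (c (n - 1) - c n) := by ring
  calc |q (n - 1) - b * c n| ≤ |q (n - 1) - b * c (n - 1)| + |b| * |c (n - 1) - c n| := by
        rw [h5, ← abs_mul]; exact abs_add_le _ _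
    _ ≤ (e + η / 2) * ((1 + θ) * c n) + |b| * (θ * c n) := by
        refine add_le_add (h1.trans ?_) ?_
        · exact mul_le_mul_of_nonneg_left h4 (by positivity)
        · exact mul_le_mul_of_nonneg_left h2 (abs_nonneg b)
    _ = (e + η / 2 + θ * (e + η / 2 + |b|)) * c n := by ring
    _ = (e + η) * c n := by rw [h3]; ring

theorem shift (hc : IsConvolutionIdempotent c) (he : 0 ≤ e) (hq : Near c q b e) (k : ℕ) :
    Near c (fun n => q (n - k)) b e := by
  induction k with
  | zero => exact hq
  | succ k ih =>
    refine (ih.pred hc he).congr' (Eventually.of_forall fun n => ?_)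
    rw [Nat.sub_sub, add_comm]

theorem partial_conv (hc : IsConvolutionIdempotent c) (hp : ∀ n, 0 ≤ p n) (he : 0 ≤ e)
    (hq : Near c q b e) (M : ℕ) :
    Near c (fun n => ∑ k ∈ Finset.range M, p k * q (n - k))
      ((∑ k ∈ Finset.range M, p k) * b) ((∑ k ∈ Finset.range M, p k) * e) := by
  induction M with
  | zero =>
    intro η hη
    filter_upwards with n
    simpa using mul_nonneg hη.le (hc.nonneg n)
  | succ M ih =>
    simp only [Finset.sum_range_succ, add_mul]
    have h := (hq.shift hc he M).const_mul hc.nonneg (p M)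
    rw [abs_of_nonneg (hp M)] at h
    exact ih.add h

end Near

/-- The three pieces are: left index below `M`, right index below `M`, both at least `M`. The first
two are disjoint since `2 * M ≤ n`. -/
theorem sum_antidiagonal_split (p q : ℕ → ℝ) {M n : ℕ} (h : 2 * M ≤ n) :
    ∑ x ∈ Finset.HasAntidiagonal.antidiagonal n, p x.1 * q x.2 =
      ∑ k ∈ Finset.range M, p k * q (n - k) + ∑ k ∈ Finset.range M, q k * p (n - k) +
        ∑ k ∈ Finset.Ico M (n + 1 - M), p k * q (n - k) := by
  rw [Finset.Nat.sum_antidiagonal_eq_sum_range_succ (fun i j => p i * q j),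
    Finset.range_eq_Ico, Finset.range_eq_Ico,
    ← Finset.sum_Ico_consecutive _ (Nat.zero_le M) (show M ≤ n.succ by omega),
    ← Finset.sum_Ico_consecutive _ (show M ≤ n + 1 - M by omega) (show n + 1 - M ≤ n.succ by omega)]
  have h1 : ∑ k ∈ Finset.Ico (n + 1 - M) n.succ, p k * q (n - k) =
      ∑ k ∈ Finset.Ico 0 M, q k * p (n - k) := by
    have h2 := Finset.sum_Ico_reflect (fun k => p k * q (n - k)) 0 (show M ≤ n + 1 by omega)
    rw [Nat.sub_zero] at h2
    rw [Nat.succ_eq_add_one, ← h2]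
    refine Finset.sum_congr rfl fun k hk => ?_
    rw [Finset.mem_Ico] at hk
    rw [Nat.sub_sub_self (by omega), mul_comm]
  rw [h1]
  ring

/-- The main contribution comes from pairs with one small index, where slow variation of `c` allows
termwise limits. The pairs with both indices large are negligible because this holds for `c * c`. -/
theorem Near.conv {c p q : ℕ → ℝ} {a b d e : ℝ} (hc : IsConvolutionIdempotent c)
    (hp0 : ∀ n, 0 ≤ p n) (hpc : ∀ n, p n ≤ c n) (hq0 : ∀ n, 0 ≤ q n) (hqc : ∀ n, q n ≤ c n)
    (hd : 0 ≤ d) (he : 0 ≤ e) (hp : Near c p a d) (hq : Near c q b e) :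
    Near c (fun n => ∑ x ∈ Finset.HasAntidiagonal.antidiagonal n, p x.1 * q x.2)
      ((∑' k, p k) * b + (∑' k, q k) * a) ((∑' k, p k) * e + (∑' k, q k) * d) := by
  have hcs := hc.hasSum.summable
  have hps := (Summable.of_nonneg_of_le hp0 hpc hcs).hasSum.tendsto_sum_nat
  have hqs := (Summable.of_nonneg_of_le hq0 hqc hcs).hasSum.tendsto_sum_nat
  have key : ∀ M, Near c (fun n => ∑ x ∈ Finset.HasAntidiagonal.antidiagonal n, p x.1 * q x.2)
      ((∑ k ∈ Finset.range M, p k) * b + (∑ k ∈ Finset.range M, q k) * a)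
      ((∑ k ∈ Finset.range M, p k) * e + (∑ k ∈ Finset.range M, q k) * d +
        (1 - 2 * ∑ k ∈ Finset.range M, c k)) := by
    intro M
    -- The middle piece is dominated by that of `c * c`, which is `c n` minus the two end pieces,
    -- asymptotically `(1 - 2 * ∑ k < M, c k) * c n`.
    have hmid : Near c (fun n => ∑ k ∈ Finset.Ico M (n + 1 - M), p k * q (n - k)) 0
        (1 - 2 * ∑ k ∈ Finset.range M, c k) := by
      have h1 := (Near.self hc.nonneg).add ((((Near.self hc.nonneg).partial_conv hc hc.nonneg
        le_rfl M).const_mul hc.nonneg (-2)))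
      intro η hη
      filter_upwards [h1 η hη, hc.conv_self, eventually_ge_atTop (2 * M)] with n h2 h3 h4
      have h5 := sum_antidiagonal_split c c h4
      rw [h3] at h5
      have h6 : ∑ k ∈ Finset.Ico M (n + 1 - M), p k * q (n - k) ≤
          ∑ k ∈ Finset.Ico M (n + 1 - M), c k * c (n - k) :=
        Finset.sum_le_sum fun k _ => mul_le_mul (hpc _) (hqc _) (hq0 _) (hc.nonneg _)
      have h7 : 0 ≤ ∑ k ∈ Finset.Ico M (n + 1 - M), p k * q (n - k) :=
        Finset.sum_nonneg fun k _ => mul_nonneg (hp0 _) (hq0 _)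
      rw [zero_mul, sub_zero, abs_of_nonneg h7]
      have h8 := (abs_le.mp h2).2
      simp only [mul_zero, add_zero, mul_one, zero_add] at h8
      linarith
    have h := ((hq.partial_conv hc hp0 he M).add (hp.partial_conv hc hq0 hd M)).add hmid
    rw [add_zero] at h
    refine h.congr' ?_
    filter_upwards [eventually_ge_atTop (2 * M)] with n hn
    exact (sum_antidiagonal_split p q hn).symm
  refine Near.of_forall_gt fun t ht => ?_
  -- As `M → ∞` the middle error vanishes precisely because `c` has sum `1 / 2`.
  have hlim : Tendsto (fun M => |(∑' k, p k) * b + (∑' k, q k) * a -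
      ((∑ k ∈ Finset.range M, p k) * b + (∑ k ∈ Finset.range M, q k) * a)| +
      ((∑ k ∈ Finset.range M, p k) * e + (∑ k ∈ Finset.range M, q k) * d +
        (1 - 2 * ∑ k ∈ Finset.range M, c k))) atTop
      (𝓝 (|(∑' k, p k) * b + (∑' k, q k) * a - ((∑' k, p k) * b + (∑' k, q k) * a)| +
        ((∑' k, p k) * e + (∑' k, q k) * d + (1 - 2 * (1 / 2))))) :=
    (tendsto_const_nhds.sub ((hps.mul_const b).add (hqs.mul_const a))).abs.add
      (((hps.mul_const e).add (hqs.mul_const d)).add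
        (tendsto_const_nhds.sub (hc.hasSum.tendsto_sum_nat.const_mul 2)))
  obtain ⟨M, hM⟩ := (hlim.eventually_lt_const (u := t) (by simpa using ht)).exists
  exact (key M).weaken hc.nonneg hM.le

/-! ### The recursion `h = x + (w - h) * h`: sum and ratio limit. -/

/-- The generating function identity of the recursion `h = x + (w - h) * h` at the point `1`. -/
theorem tsum_of_recursion {x w h : ℕ → ℝ} (hx : Summable x) (h0 : ∀ n, 0 ≤ h n)
    (hw : ∀ n, h n ≤ w n) (hws : Summable w)
    (hrec : ∀ n, h n = x n +
      ∑ p ∈ Finset.HasAntidiagonal.antidiagonal n, (w p.1 - h p.1) * h p.2) :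
    ∑' n, h n = ∑' n, x n + (∑' n, w n - ∑' n, h n) * ∑' n, h n := by
  have hs : Summable h := Summable.of_nonneg_of_le h0 hw hws
  have hd : Summable fun n => w n - h n := hws.sub hs
  have hs' : Summable fun n => ‖h n‖ := hs.norm
  have hd' : Summable fun n => ‖w n - h n‖ := hd.norm
  have h1 := tsum_mul_tsum_eq_tsum_sum_antidiagonal_of_summable_norm hd' hs'
  have h2 := (summable_norm_sum_mul_antidiagonal_of_summable_norm hd' hs').of_norm
  rw [← hws.tsum_sub hs, h1, ← hx.tsum_add h2]
  exact tsum_congr hrec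

/-- The ratio limit of a sequence satisfying `h = x + (w - h) * h`, with `x` eventually zero. -/
theorem tendsto_of_recursion {c x w h : ℕ → ℝ} {ω : ℝ} (hc : IsConvolutionIdempotent c)
    (hx : ∀ᶠ n in atTop, x n = 0) (h0 : ∀ n, 0 ≤ h n) (hw : ∀ n, h n ≤ w n)
    (hwc : ∀ n, w n ≤ c n)
    (hrec : ∀ n, h n = x n +
      ∑ p ∈ Finset.HasAntidiagonal.antidiagonal n, (w p.1 - h p.1) * h p.2)
    (hω : Near c w ω 0) :
    Near c h (ω * (∑' n, h n) / (1 - ∑' n, w n + 2 * ∑' n, h n)) 0 := by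
  have hw0 : ∀ n, 0 ≤ w n := fun n => (h0 n).trans (hw n)
  have hcs := hc.hasSum.summable
  have hws : Summable w := Summable.of_nonneg_of_le hw0 hwc hcs
  have hhs : Summable h := Summable.of_nonneg_of_le h0 hw hws
  have hW : ∑' n, w n ≤ 1 / 2 := (hws.tsum_le_tsum hwc hcs).trans_eq hc.hasSum.tsum_eq
  have hW0 : 0 ≤ ∑' n, w n := tsum_nonneg hw0
  have hH0 : 0 ≤ ∑' n, h n := tsum_nonneg h0
  have hsub := hws.tsum_sub hhs
  set W := ∑' n, w n
  set H := ∑' n, h n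
  set l := ω * H / (1 - W + 2 * H) with hl
  -- `l` is the fixed point of the map that the recursion induces on candidate ratio limits.
  have hlam : (W - H) * l + H * (ω - l) = l := by
    have : 1 - W + 2 * H ≠ 0 := by linarith
    have h1 : l * (1 - W + 2 * H) = ω * H := by rw [hl, div_mul_cancel₀ _ this]
    linarith
  -- An error `D` for `h` is also one for `w - h`, so the convolution has error `(W - H) * D + H * D
  -- = W * D`, and `W ≤ 1 / 2`.
  have step : ∀ D ≥ 0, Near c h l D → Near c h l (D / 2) := by
    intro D hD hN
    have hd := hω.add (hN.const_mul hc.nonneg (-1))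
    have h1 := Near.conv hc (p := fun n => w n + -1 * h n) (q := h)
      (fun n => by linarith [hw n]) (fun n => by linarith [h0 n, hwc n]) h0
      (fun n => (hw n).trans (hwc n)) (by positivity) hD hd hN
    have h2 : ∑' n, (w n + -1 * h n) = W - H := by
      rw [← hsub]
      exact tsum_congr fun n => by ring
    have h3 : (∑' n, (w n + -1 * h n)) * l + (∑' n, h n) * (ω + -1 * l) = l := by
      rw [h2]
      linarith
    rw [h3, h2] at h1
    refine (h1.weaken hc.nonneg (d := D / 2) (a := l) ?_).congr' ?_
    · rw [sub_self, abs_zero, abs_neg, abs_one]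
      change 0 + ((W - H) * D + H * (0 + 1 * D)) ≤ D / 2
      nlinarith
    · filter_upwards [hx] with n hn
      rw [hrec n, hn, zero_add]
      exact Finset.sum_congr rfl fun p _ => by ring
  have hstart : Near c h l (1 + |l|) := by
    intro η hη
    filter_upwards with n
    have h1 : |l * c n| = |l| * c n := by rw [abs_mul, abs_of_nonneg (hc.nonneg n)]
    have h2 : |h n| ≤ c n := by
      rw [abs_of_nonneg (h0 n)]
      exact (hw n).trans (hwc n)
    have h3 := abs_sub (h n) (l * c n)
    nlinarith [hc.nonneg n]
  have hiter : ∀ k : ℕ, Near c h l ((1 + |l|) * (1 / 2) ^ k) := by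
    intro k
    induction k with
    | zero => simpa using hstart
    | succ k ih =>
      have := step _ (by positivity) ih
      rwa [mul_div_assoc, div_eq_mul_one_div (_ ^ k), ← pow_succ] at this
  refine Near.of_forall_gt fun D hD => ?_
  have hlim : Tendsto (fun k : ℕ => (1 + |l|) * (1 / 2 : ℝ) ^ k) atTop (𝓝 ((1 + |l|) * 0)) :=
    (tendsto_pow_atTop_nhds_zero_of_lt_one (by norm_num) (by norm_num)).const_mul _
  obtain ⟨k, hk⟩ := (hlim.eventually_lt_const (u := D) (by simpa using hD)).exists
  exact (hiter k).weaken hc.nonneg (by simpa using hk.le)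

/-! ### The rescaled counting sequences. -/

/-- The exponential rescaling `k n / 16 ^ n` of a counting sequence. -/
noncomputable def scaled (k : ℕ → ℕ) (n : ℕ) : ℝ := (k n : ℝ) / 16 ^ n

theorem scaled_nonneg (k : ℕ → ℕ) (n : ℕ) : 0 ≤ scaled k n := by
  unfold scaled
  positivity

theorem scaled_div_scaled (k l : ℕ → ℕ) (n : ℕ) :
    scaled k n / scaled l n = (k n : ℝ) / (l n : ℝ) :=
  div_div_div_cancel_right₀ (by positivity) _ _

theorem scaled_add {w h r : ℕ → ℕ} (hw : ∀ n, w n = r n + h n) (n : ℕ) :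
    scaled w n = scaled r n + scaled h n := by
  simp only [scaled, hw, Nat.cast_add, add_div]

theorem scaled_recursion {k : ℕ} {h p q : ℕ → ℕ} (hrec : ∀ n, h n = (if n = 1 then k else 0) +
    ∑ x ∈ Finset.HasAntidiagonal.antidiagonal n, p x.1 * q x.2) (n : ℕ) :
    scaled h n = (if n = 1 then (k : ℝ) / 16 else 0) +
      ∑ x ∈ Finset.HasAntidiagonal.antidiagonal n, scaled p x.1 * scaled q x.2 := by
  rw [scaled, hrec, Nat.cast_add, add_div, Nat.cast_sum, Finset.sum_div]
  congr 1
  · split_ifs with h1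
    · rw [h1, pow_one]
    · simp
  · refine Finset.sum_congr rfl fun x hx => ?_
    rw [Finset.HasAntidiagonal.mem_antidiagonal] at hx
    rw [← hx, scaled, scaled, pow_add, Nat.cast_mul, div_mul_div_comm]

theorem scaled_gCount_zero : scaled gCount 0 = 0 := by
  simp [scaled, gCount_zero]

theorem scaled_gCount_ratio (n : ℕ) :
    ((n : ℝ) + 2) * scaled gCount (n + 2) = (n + 1 / 2) * scaled gCount (n + 1) := by
  have h := gCount_ratio n
  simp only [scaled]
  rw [mul_div_assoc', mul_div_assoc', h, div_eq_div_iff (by positivity) (by positivity)]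
  ring

/-- A telescoping sum: by `scaled_gCount_ratio`, each term is a difference of consecutive values of
`2 * n * scaled gCount n`. -/
theorem sum_range_scaled_gCount (n : ℕ) :
    ∑ k ∈ Finset.range (n + 1), scaled gCount k = 1 / 2 - 2 * (n + 1) * scaled gCount (n + 1) := by
  induction n with
  | zero =>
    have h : gCount 1 = 4 := by simpa using gCount_succ 0
    simp [scaled, gCount_zero, h]
    norm_num
  | succ n ih =>
    rw [Finset.sum_range_succ, ih]
    push_cast
    linear_combination 2 * scaled_gCount_ratio n

theorem summable_scaled_gCount : Summable (scaled gCount) := by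
  refine summable_of_sum_range_le (c := 1 / 2) (scaled_nonneg _) fun n => ?_
  rcases n with _ | n
  · simp
  · rw [sum_range_scaled_gCount]
    have := scaled_nonneg gCount (n + 1)
    have : 0 ≤ 2 * ((n : ℝ) + 1) * scaled gCount (n + 1) := by positivity
    linarith

theorem hasSum_ite_one (t : ℝ) : HasSum (fun n : ℕ => if n = 1 then t else 0) t :=
  hasSum_ite_eq 1 t

/-- The recursion gives `S = 1 / 4 + S ^ 2` for the sum `S`, with double root `1 / 2`. -/
theorem tsum_scaled_gCount : ∑' n, scaled gCount n = 1 / 2 := by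
  have hs := summable_scaled_gCount
  have hn : Summable fun n => ‖scaled gCount n‖ := hs.norm
  have h1 := tsum_mul_tsum_eq_tsum_sum_antidiagonal_of_summable_norm hn hn
  have h2 := (summable_norm_sum_mul_antidiagonal_of_summable_norm hn hn).of_norm
  have h3 : ∑' n, scaled gCount n = _ := tsum_congr (scaled_recursion gCount_eq)
  rw [(hasSum_ite_one _).summable.tsum_add h2, (hasSum_ite_one _).tsum_eq, ← h1] at h3
  push_cast at h3
  nlinarith [sq_nonneg (∑' n, scaled gCount n - 1 / 2)]

theorem isConvolutionIdempotent_scaled_gCount : IsConvolutionIdempotent (scaled gCount) where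
  nonneg := scaled_nonneg _
  eventually_pos := by
    filter_upwards [eventually_ge_atTop 1] with n hn
    obtain ⟨m, rfl⟩ := Nat.exists_eq_add_of_le' hn
    exact div_pos (by exact_mod_cast gCount_succ_pos m) (by positivity)
  near_pred := by
    intro η hη
    -- The relative gap between the terms of index `m + 1` and `m + 2` is `(3 / 2) / (m + 1 / 2)`.
    obtain ⟨N, hN⟩ := exists_nat_gt (3 / 2 / η)
    filter_upwards [eventually_ge_atTop (N + 2)] with n hn
    obtain ⟨m, rfl⟩ := Nat.exists_eq_add_of_le' (show 2 ≤ n by omega)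
    have hm : (N : ℝ) ≤ m := by exact_mod_cast (show N ≤ m by omega)
    have h1 := scaled_gCount_ratio m
    have h2 := scaled_nonneg gCount (m + 2)
    have h3 : 3 / 2 ≤ η * (m + 1 / 2) := by
      rw [div_lt_iff₀ hη] at hN
      nlinarith
    have h4 : (m + 1 / 2 : ℝ) * (scaled gCount (m + 1) - scaled gCount (m + 2)) =
        3 / 2 * scaled gCount (m + 2) := by linear_combination -h1
    have hpos : (0 : ℝ) < m + 1 / 2 := by positivity
    have h5 : 0 ≤ scaled gCount (m + 1) - scaled gCount (m + 2) :=
      nonneg_of_mul_nonneg_right (by rw [h4]; positivity) hpos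
    have h6 : m + 2 - 1 = m + 1 := by omega
    rw [h6, one_mul, zero_add, abs_of_nonneg h5]
    refine le_of_mul_le_mul_left ?_ hpos
    rw [h4]
    nlinarith
  conv_self := by
    filter_upwards [eventually_ge_atTop 2] with n hn
    rw [scaled_recursion gCount_eq n, if_neg (by omega), zero_add]
  hasSum := by
    rw [← tsum_scaled_gCount]
    exact summable_scaled_gCount.hasSum

/-- The sum and the ratio limit of a counting sequence with recursion `h = x + r * h`, in terms of
those of `w = r + h` and the square root `s` of the discriminant. -/
theorem split_count {w h r : ℕ → ℕ} {W s ω : ℝ}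
    (hrec : ∀ n, h n = (if n = 1 then 1 else 0) +
      ∑ x ∈ Finset.HasAntidiagonal.antidiagonal n, r x.1 * h x.2)
    (hw : ∀ n, w n = r n + h n) (hwg : ∀ n, w n ≤ gCount n)
    (hW : HasSum (scaled w) W) (hs : 0 ≤ s) (hsq : s ^ 2 = (1 - W) ^ 2 + 1 / 4)
    (hω : Near (scaled gCount) (scaled w) ω 0) :
    HasSum (scaled r) (W - (s - (1 - W)) / 2) ∧
      Near (scaled gCount) (scaled h) (ω * ((s - (1 - W)) / 2) / s) 0 ∧
      Near (scaled gCount) (scaled r) (ω - ω * ((s - (1 - W)) / 2) / s) 0 := by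
  have hc := isConvolutionIdempotent_scaled_gCount
  have hadd := scaled_add hw
  have hhw : ∀ n, scaled h n ≤ scaled w n := fun n => by
    rw [hadd]
    linarith [scaled_nonneg r n]
  have hwc : ∀ n, scaled w n ≤ scaled gCount n := fun n =>
    div_le_div_of_nonneg_right (by exact_mod_cast hwg n) (by positivity)
  have hhs : Summable (scaled h) := Summable.of_nonneg_of_le (scaled_nonneg h) hhw hW.summable
  have hrec' : ∀ n, scaled h n = (if n = 1 then ((1 : ℕ) : ℝ) / 16 else 0) +
      ∑ p ∈ Finset.HasAntidiagonal.antidiagonal n,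
        (scaled w p.1 - scaled h p.1) * scaled h p.2 := fun n => by
    rw [scaled_recursion hrec n]
    congr 1
    refine Finset.sum_congr rfl fun p _ => ?_
    rw [hadd]
    ring
  have hsum := tsum_of_recursion (hasSum_ite_one _).summable (scaled_nonneg h) hhw hW.summable hrec'
  rw [(hasSum_ite_one _).tsum_eq, hW.tsum_eq] at hsum
  have hnear := tendsto_of_recursion hc (x := fun n => if n = 1 then ((1 : ℕ) : ℝ) / 16 else 0)
    (by filter_upwards [eventually_ge_atTop 2] with n hn; exact if_neg (by omega))
    (scaled_nonneg h) hhw hwc hrec' hω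
  rw [hW.tsum_eq] at hnear
  have hH0 : 0 ≤ ∑' n, scaled h n := tsum_nonneg (scaled_nonneg h)
  have hW2 : W ≤ 1 / 2 := hasSum_le hwc hW hc.hasSum
  -- Completing the square in `H = 1 / 16 + (W - H) * H` gives `(1 - W + 2 * H) ^ 2 = (1 - W) ^ 2 +
  -- 1 / 4`; the bound `W ≤ 1 / 2` selects the nonnegative root.
  have hdisc : 1 - W + 2 * ∑' n, scaled h n = s := by
    refine (pow_left_inj₀ (by linarith) hs two_ne_zero).mp ?_
    push_cast at hsum
    linear_combination 4 * hsum - hsq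
  have hH : ∑' n, scaled h n = (s - (1 - W)) / 2 := by linarith
  rw [hdisc, hH] at hnear
  have hsub : ∀ n, scaled w n - scaled h n = scaled r n := fun n => by
    rw [hadd]
    ring
  refine ⟨?_, hnear, ?_⟩
  · rw [← hH]
    have := hW.sub hhs.hasSum
    simpa only [hsub] using this
  · refine ((hω.add (hnear.const_mul hc.nonneg (-1))).weaken hc.nonneg ?_).congr'
      (Eventually.of_forall fun n => ?_)
    · rw [mul_zero, add_zero, add_zero, neg_one_mul, ← sub_eq_add_neg, sub_self, abs_zero]
    · rw [neg_one_mul, ← sub_eq_add_neg, hsub]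

/-! ### Numerical enclosure and assembly of the closed forms. -/

theorem pTop_bounds {r α β γ : ℝ} (hr : r = √2) (hβ : β = √(7 + 2 * r)) (hα : α = 1 + r + β)
    (hγ : γ = √(16 + α ^ 2)) :
    0.684122210733017786 ≤ (2 + r) * α * (α + γ) / (16 * β * γ) ∧
      (2 + r) * α * (α + γ) / (16 * β * γ) < 0.684122210733017787 := by
  have hr1 : 1.414213562373095048801688724209 ≤ r := by rw [hr]; exact Real.le_sqrt_of_sq_le (by norm_num)
  have hr2 : r ≤ 1.414213562373095048801688724210 := by
    rw [hr]; exact Real.sqrt_le_iff.mpr ⟨by norm_num, by norm_num⟩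
  have hβ1 : 3.1350322366358834775948105516 ≤ β := by
    rw [hβ]; exact Real.le_sqrt_of_sq_le (by linarith)
  have hβ2 : β ≤ 3.1350322366358834775948105517 := by
    rw [hβ]; exact Real.sqrt_le_iff.mpr ⟨by norm_num, by linarith⟩
  have hα1 : 5.549245799008978526396499275809 ≤ α := by linarith
  have hα2 : α ≤ 5.549245799008978526396499275910 := by linarith
  have hγ1 : 6.84062343195551120966689617 ≤ γ := by
    rw [hγ]
    refine Real.le_sqrt_of_sq_le ?_
    have := pow_le_pow_left₀ (by norm_num) hα1 2
    linarith
  have hγ2 : γ ≤ 6.84062343195551120966689618 := by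
    rw [hγ]
    refine Real.sqrt_le_iff.mpr ⟨by norm_num, ?_⟩
    have := pow_le_pow_left₀ (by linarith) hα2 2
    linarith
  have hβ0 : 0 < β := by linarith
  have hγ0 : 0 < γ := by linarith
  have hα0 : 0 < α := by linarith
  have hr0 : 0 < r := by linarith
  constructor
  · rw [le_div_iff₀ (by positivity)]
    calc 0.684122210733017786 * (16 * β * γ) ≤ 0.684122210733017786 *
          (16 * 3.1350322366358834775948105517 * 6.84062343195551120966689618) := by gcongr
      _ ≤ (2 + 1.414213562373095048801688724209) * 5.549245799008978526396499275809 *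
          (5.549245799008978526396499275809 + 6.84062343195551120966689617) := by norm_num
      _ ≤ (2 + r) * α * (α + γ) := by gcongr
  · rw [div_lt_iff₀ (by positivity)]
    calc (2 + r) * α * (α + γ) ≤ (2 + 1.414213562373095048801688724210) *
          5.549245799008978526396499275910 *
          (5.549245799008978526396499275910 + 6.84062343195551120966689618) := by gcongr
      _ < 0.684122210733017787 * (16 * 3.1350322366358834775948105516 *
          6.84062343195551120966689617) := by norm_num
      _ ≤ 0.684122210733017787 * (16 * β * γ) := by gcongr

theorem theorem2 (α β γ : ℝ)
    (hβ : β = Real.sqrt (7 + 2 * Real.sqrt 2))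
    (hα : α = 1 + Real.sqrt 2 + β)
    (hγ : γ = Real.sqrt (16 + α ^ 2)) :
    ∃ pBot pA pB pTop : ℝ,
      Tendsto (fun n : ℕ => (fCount n : ℝ) / (gCount n : ℝ)) atTop (𝓝 pBot) ∧
      Tendsto (fun n : ℕ => (aCount n : ℝ) / (gCount n : ℝ)) atTop (𝓝 pA) ∧
      Tendsto (fun n : ℕ => (bCount n : ℝ) / (gCount n : ℝ)) atTop (𝓝 pB) ∧
      Tendsto (fun n : ℕ => (tCount n : ℝ) / (gCount n : ℝ)) atTop (𝓝 pTop) ∧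
      pBot + pA + pB + pTop = 1 ∧
      pBot = 1 / 2 - Real.sqrt 2 / 4 ∧
      pA = (2 + Real.sqrt 2) / (2 * α * β) ∧
      pB = (2 + Real.sqrt 2) * α / (β * γ * (α + γ)) ∧
      pTop = (2 + Real.sqrt 2) * α * (α + γ) / (16 * β * γ) ∧
      0.684122210733017786 ≤ pTop ∧ pTop < 0.684122210733017787 := by
  have hbounds := pTop_bounds rfl hβ hα hγ
  have hc := isConvolutionIdempotent_scaled_gCount
  have hr2 : √2 ^ 2 = (2 : ℝ) := Real.sq_sqrt (by norm_num)
  have hr0 : 0 < √(2 : ℝ) := by positivity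
  have hβ0 : 0 < β := by rw [hβ]; positivity
  have hβ2 : β ^ 2 = 7 + 2 * √2 := by rw [hβ]; exact Real.sq_sqrt (by positivity)
  have hα0 : 0 < α := by rw [hα]; positivity
  have hγ0 : 0 < γ := by rw [hγ]; positivity
  have hγ2 : γ ^ 2 = 16 + α ^ 2 := by rw [hγ]; exact Real.sq_sqrt (by positivity)
  set r := √(2 : ℝ)
  -- In the three rounds `1 - W` is `1 / 2`, `(1 + r) / 4`, `α / 8`, so the discriminant roots are
  -- `r / 2`, `β / 4`, `γ / 8`.
  obtain ⟨hF, hf, hf'⟩ := split_count (W := 1 / 2) (s := r / 2) (ω := 1)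
    (r := fun n => aCount n + bCount n + tCount n) (h := fCount) (w := gCount) fCount_eq
    (fun n => by rw [gCount]; ring) (fun n => le_rfl) hc.hasSum (by positivity)
    (by linear_combination hr2 / 4) (Near.self hc.nonneg)
  obtain ⟨hA, ha, ha'⟩ := split_count (s := β / 4) (r := fun n => bCount n + tCount n) (h := aCount)
    aCount_eq (fun n => by ring) (fun n => by rw [gCount]; omega) hF (by positivity)
    (by linear_combination hβ2 / 16 - hr2 / 16) hf'
  obtain ⟨-, hb, ht⟩ := split_count (s := γ / 8) (r := tCount) (h := bCount) bCount_eq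
    (fun n => by ring) (fun n => by rw [gCount]; omega) hA (by positivity)
    (by rw [hα] at hγ2; linear_combination hγ2 / 64) ha'
  have e1 : 1 * ((r / 2 - (1 - 1 / 2)) / 2) / (r / 2) = 1 / 2 - r / 4 := by
    field_simp
    linear_combination 2 * hr2
  rw [e1] at hf ha hb ht
  have e2 : (1 - (1 / 2 - r / 4)) * ((β / 4 - (1 - (1 / 2 - (r / 2 - (1 - 1 / 2)) / 2))) / 2) /
      (β / 4) = (2 + r) / (2 * α * β) := by
    -- Rationalisation: `α` is the conjugate `β + (1 + r)`, and `β ^ 2 - (1 + r) ^ 2 = 4`. The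
    -- relation `hγα` below plays the same role for `γ`.
    have h : (β - 1 - r) * α = 4 := by
      rw [hα]
      linear_combination hβ2 - hr2
    rw [div_eq_div_iff (by positivity) (by positivity)]
    linear_combination β * (2 + r) / 16 * h
  rw [e2] at ha hb ht
  have e3 : 1 - (1 / 2 - r / 4) - (2 + r) / (2 * α * β) = (2 + r) * α / (8 * β) := by
    have h : 2 * α * β - 4 = α ^ 2 := by
      rw [hα]
      linear_combination hβ2 - hr2
    field_simp
    linear_combination 8 * (2 + r) * h
  rw [e3] at hb ht
  have hγα : (γ - α) * (γ + α) = 16 := by linear_combination hγ2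
  have e4 : ∀ W : ℝ, 1 - W = α / 8 → (2 + r) * α / (8 * β) * ((γ / 8 - (1 - W)) / 2) / (γ / 8) =
      (2 + r) * α / (β * γ * (α + γ)) := by
    intro W hW
    rw [hW]
    field_simp
    linear_combination hγα
  rw [e4 _ (by rw [hα]; ring)] at hb ht
  have e5 : (2 + r) * α / (8 * β) - (2 + r) * α / (β * γ * (α + γ)) =
      (2 + r) * α * (α + γ) / (16 * β * γ) := by
    field_simp
    linear_combination 8 * hγα
  rw [e5] at ht
  have hlim : ∀ {k : ℕ → ℕ} {p : ℝ}, Near (scaled gCount) (scaled k) p 0 →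
      Tendsto (fun n : ℕ => (k n : ℝ) / (gCount n : ℝ)) atTop (𝓝 p) := fun {k p} h => by
    simpa only [scaled_div_scaled] using h.tendsto_div hc.eventually_pos
  exact ⟨_, _, _, _, hlim hf, hlim ha, hlim hb, hlim ht, by linarith, rfl, rfl, rfl, rfl, hbounds⟩
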